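/- Let $K$ be an infinite field, $n\ge 0$, and let $S=K[x_1,\dots,x_n]$ carry the standard grading. For $F\subseteq[n]=\{1,\dots,n\}$ write $x_F=\prod_{i\in F}x_i$. For a nonzero finitely generated graded $S$-module $M$, let $\dim M$ be its Krull dimension and let $\operatorname{depth}(M)$ be the maximal length of an $M$-regular sequence contained in the ideal $(x_1,\dots,x_n)$; $M$ is called Cohen–Macaulay if $\operatorname{depth}(M)=\dim M$. The Hilbert depth $\operatorname{hdepth}(M)$ is the maximum of $\operatorname{depth}(N)$ over all finitely generated graded $S$-modules $N$ with the same Hilbert series as $M$, that is, with $\dim_K N_j=\dim_K M_j$ for all $j$. **Theorem.** Let $0\subseteq I\subsetneq J\subseteq S$ be two ideals generated by squarefree monomials. Put $\Delta=\{F\subseteq[n] : x_F\notin I\}$ and $\Gamma=\{F\subseteq[n] : x_F\notin J\}$, and let $\Psi=(\Delta,\Gamma)$ be the associated relative simplicial complex, so that $\dim\Psi=\max\{|F|-1 : F\in\Delta\setminus\Gamma\}$. Then $\dim(J/I)=\dim\Psi+1$, and: 1. $\operatorname{hdepth}(J/I)\le\dim(J/I)$. 2. If $J/I$ is Cohen–Macaulay,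 then $\operatorname{hdepth}(J/I)=\dim(J/I)=\operatorname{depth}(J/I)$. -/

import Mathlib

universe u

namespace SqfreeHilbertDepth

open MvPolynomial

noncomputable section

/-- The squarefree monomial `x_F = ∏_{i ∈ F} x_i`. -/
def sqfreeMonomial {n : ℕ} (K : Type u) [Field K] (F : Finset (Fin n)) :
    MvPolynomial (Fin n) K :=
  ∏ i ∈ F, X i

/-- An ideal generated by squarefree monomials (the zero ideal and the unit ideal included). -/
def IsSqfreeMonomialIdeal {n : ℕ} {K : Type u} [Field K]
    (I : Ideal (MvPolynomial (Fin n) K)) : Prop :=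
  ∃ A : Set (Finset (Fin n)), I = Ideal.span (sqfreeMonomial K '' A)

/-- The Stanley–Reisner complex `Δ(I) = {F ⊆ [n] : x_F ∉ I}`, as a family of subsets of `[n]` closed
under taking subsets. It is void exactly when `I` is the unit ideal. -/
def stanleyReisnerComplex {n : ℕ} {K : Type u} [Field K]
    (I : Ideal (MvPolynomial (Fin n) K)) : LowerSet (Finset (Fin n)) where
  carrier := {F | sqfreeMonomial K F ∉ I}
  lower' := by
    intro F G hGF hF hG
    exact hF (I.mem_of_dvd (Finset.prod_dvd_prod_of_subset G F _ hGF) hG)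

/-- The dimension of the relative simplicial complex `Ψ = (Δ, Γ)`: the maximum of
`dim F = |F| - 1` over the faces `F ∈ Δ \ Γ` (there is at least one face wherever this is used). -/
def relDim {n : ℕ} (Δ Γ : LowerSet (Finset (Fin n))) : ℤ :=
  sSup ((fun F : Finset (Fin n) => (F.card : ℤ) - 1) '' {F | F ∈ Δ ∧ F ∉ Γ})

/-- The depth of a finitely generated graded module over `S = K[x_1, …, x_n]`: the supremum of the
lengths of the `M`-regular sequences contained in the ideal `(x_1, …, x_n)`. -/
def depth (K : Type u) [Field K] (n : ℕ) (M : Type u) [AddCommGroup M]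
    [Module (MvPolynomial (Fin n) K) M] : ℕ∞ :=
  sSup {r : ℕ∞ | ∃ fs : List (MvPolynomial (Fin n) K),
    (∀ f ∈ fs, f ∈ Ideal.span (Set.range (X : Fin n → MvPolynomial (Fin n) K))) ∧
    RingTheory.Sequence.IsRegular M fs ∧ r = (fs.length : ℕ∞)}

/-- `M` is Cohen–Macaulay: its depth equals its Krull dimension (the Krull dimension of its
support); used for nonzero finitely generated graded modules only. -/
def IsCohenMacaulay (K : Type u) [Field K] (n : ℕ) (M : Type u) [AddCommGroup M]
    [Module (MvPolynomial (Fin n) K) M] : Prop :=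
  (depth K n M : WithBot ℕ∞) = Module.supportDim (MvPolynomial (Fin n) K) M

/-- `ℳ` is a grading of the `S`-module `M`, where `S = K[x_1, …, x_n]` has the standard grading:
`M = ⨁_j M_j` and `S_i M_j ⊆ M_{i+j}`. -/
structure IsGrading (K : Type u) [Field K] (n : ℕ) {M : Type u} [AddCommGroup M] [Module K M]
    [Module (MvPolynomial (Fin n) K) M] (ℳ : ℕ → Submodule K M) : Prop where
  isInternal : DirectSum.IsInternal ℳ
  smul_mem : ∀ (i j : ℕ) (f : MvPolynomial (Fin n) K) (m : M),
    f ∈ homogeneousSubmodule (Fin n) K i → m ∈ ℳ j → f • m ∈ ℳ (i + j)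

/-- The Hilbert series `∑_{j ≥ 0} (dim_K M_j) t^j` (of a finitely generated graded module, so that
all the `M_j` are finite-dimensional). -/
def hilbertSeries {K : Type u} [Field K] {M : Type u} [AddCommGroup M] [Module K M]
    (ℳ : ℕ → Submodule K M) : PowerSeries ℤ :=
  PowerSeries.mk fun j => (Module.finrank K (ℳ j) : ℤ)

/-- The Hilbert depth of a module `M` with grading `ℳ`: the largest depth of a finitely generated
graded `S`-module `N` with the same Hilbert series. As `M` lives in degrees `≥ 0`, so does every
such `N`. -/
def hilbertDepth {K : Type u} [Field K] (n : ℕ) {M : Type u} [AddCommGroup M] [Module K M]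
    (ℳ : ℕ → Submodule K M) : ℕ∞ :=
  sSup {r : ℕ∞ | ∃ (N : Type u) (_ : AddCommGroup N) (_ : Module K N)
    (_ : Module (MvPolynomial (Fin n) K) N)
    (_ : IsScalarTower K (MvPolynomial (Fin n) K) N) (𝒩 : ℕ → Submodule K N),
    IsGrading K n 𝒩 ∧ Module.Finite (MvPolynomial (Fin n) K) N ∧
    hilbertSeries 𝒩 = hilbertSeries ℳ ∧ r = depth K n N}

/-- The module `J/I` (for `I ⊆ J`). -/
abbrev QuotMod {n : ℕ} {K : Type u} [Field K] (I J : Ideal (MvPolynomial (Fin n) K)) : Type u :=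
  ↥J ⧸ Submodule.submoduleOf I J

/-- The standard grading of `J/I` (for homogeneous `I ⊆ J`): its degree-`j` piece is the image of
`J ∩ S_j`. -/
def quotGrading {n : ℕ} {K : Type u} [Field K] (I J : Ideal (MvPolynomial (Fin n) K)) (j : ℕ) :
    Submodule K (QuotMod I J) :=
  ((homogeneousSubmodule (Fin n) K j).comap (J.subtype.restrictScalars K)).map
    ((Submodule.submoduleOf I J).mkQ.restrictScalars K)

end

end SqfreeHilbertDepth

/-! The bound on Hilbert depth is a comparison of growth rates. A regular sequence of length `r` on
`N` yields `t ^ r` linearly independent elements of degree at most linear in `t`, so the summed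
Hilbert function of `N` grows at least like `T ^ r` (`IsGrading.exists_pow_le_sum_finrank`). In
`J/I` the monomials that survive have support in `Δ \ Γ`, hence involve at most `d` variables, where
`d` is the largest size of such a face, and the sum is at most `2 ^ n * (T + 1) ^ d`
(`sum_finrank_quotGrading_le`). Equal Hilbert series force `r ≤ d`.

The number `d` is also the Krull dimension, by `supportDim_quotMod_le` and
`card_le_supportDim_quotMod`. In the Cohen–Macaulay case `J/I` itself attains the bound. -/

namespace SqfreeHilbertDepth

open MvPolynomial

/-! ### Independent elements produced by regular sequences -/

section RegularSequences

open scoped Pointwise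

variable {K : Type*} [Field K]

/-- Reducing a relation modulo `x` kills the coefficients at exponent 0. What remains is a multiple
of `x`, which regularity cancels, leaving a relation with fewer powers. -/
theorem linearIndependent_pow_smul {S : Type*} [CommRing S] [Algebra K S] {M : Type*}
    [AddCommGroup M] [Module K M] [Module S M] [IsScalarTower K S M] {ι : Type*} [Fintype ι]
    {x : S} (hx : IsSMulRegular M x) (v : ι → M)
    (hv : LinearIndependent K (fun i => (Submodule.Quotient.mk (v i) : QuotSMulTop x M)))
    (t : ℕ) :
    LinearIndependent K (fun p : Fin t × ι => x ^ (p.1 : ℕ) • v p.2) := by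
  have := IsScalarTower.to_smulCommClass (R := K) (A := S) (M := M)
  rw [Fintype.linearIndependent_iff] at hv ⊢
  induction t with
  | zero => exact fun _ _ p => p.1.elim0
  | succ t ih =>
    intro c hc
    rw [Fintype.sum_prod_type, Fin.sum_univ_succ] at hc
    have hsplit : (∑ i, c (0, i) • v i) +
        x • ∑ p : Fin t × ι, c (p.1.succ, p.2) • x ^ (p.1 : ℕ) • v p.2 = 0 := by
      rw [← hc, Fintype.sum_prod_type, Finset.smul_sum]
      congr 1
      · simp
      · refine Finset.sum_congr rfl fun k _ => ?_
        rw [Finset.smul_sum]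
        refine Finset.sum_congr rfl fun i _ => ?_
        rw [smul_comm x, smul_smul, ← pow_succ', Fin.val_succ]
    have h0 : ∀ i, c (0, i) = 0 := by
      refine hv (fun i => c (0, i)) ?_
      have h := congrArg (fun m => (Submodule.Quotient.mk m : QuotSMulTop x M)) hsplit
      simp only [Submodule.Quotient.mk_add] at h
      rw [(Submodule.Quotient.mk_eq_zero _).2
        (Submodule.smul_mem_pointwise_smul _ x ⊤ Submodule.mem_top), add_zero] at h
      rw [← Submodule.Quotient.mk_zero, ← h]
      exact (map_sum ((x • (⊤ : Submodule S M)).mkQ.restrictScalars K)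
        (fun i => c (0, i) • v i) Finset.univ).symm
    have h1 := ih (fun p => c (p.1.succ, p.2)) (by
      refine hx.right_eq_zero_of_smul ?_
      simpa [h0] using hsplit)
    rintro ⟨k, i⟩
    exact Fin.cases (h0 i) (fun k => h1 (k, i)) k

/-- The monomials in a regular sequence act independently on a suitable element. -/
theorem exists_linearIndependent_smul {σ : Type*} (D : ℕ) (rs : List (MvPolynomial σ K))
    (hD : ∀ r ∈ rs, r.totalDegree ≤ D) :
    ∀ (M : Type u) [AddCommGroup M] [Module K M] [Module (MvPolynomial σ K) M]
      [IsScalarTower K (MvPolynomial σ K) M], RingTheory.Sequence.IsRegular M rs →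
      ∃ m : M, ∀ t : ℕ, ∃ (ι : Type) (_ : Fintype ι) (g : ι → MvPolynomial σ K),
        Fintype.card ι = t ^ rs.length ∧ (∀ k, (g k).totalDegree ≤ t * D * rs.length) ∧
        LinearIndependent K (fun k => g k • m) := by
  induction rs with
  | nil =>
    intro M _ _ _ _ h
    have := h.nontrivial
    obtain ⟨m, hm⟩ := exists_ne (0 : M)
    exact ⟨m, fun t => ⟨Unit, inferInstance, fun _ => 1, by simp, by simp,
      linearIndependent_unique_iff.2 (by simpa using hm)⟩⟩
  | cons x rs ih =>
    intro M _ _ _ _ h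
    rw [RingTheory.Sequence.isRegular_cons_iff] at h
    obtain ⟨m', hm'⟩ := ih (fun r hr => hD r (List.mem_cons_of_mem _ hr)) (QuotSMulTop x M) h.2
    obtain ⟨m, rfl⟩ := Submodule.Quotient.mk_surjective _ m'
    -- The lift `m` is fixed before `t`, so its degree later enters as a constant.
    refine ⟨m, fun t => ?_⟩
    obtain ⟨ι, _, g, hcard, hdeg, hli⟩ := hm' t
    refine ⟨Fin t × ι, inferInstance, fun p => x ^ (p.1 : ℕ) * g p.2, ?_, ?_, ?_⟩
    · simp [hcard, pow_succ']
    · intro p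
      refine (totalDegree_mul _ _).trans ?_
      have h1 : (x ^ (p.1 : ℕ)).totalDegree ≤ t * D :=
        (totalDegree_pow _ _).trans (Nat.mul_le_mul p.1.2.le (hD x List.mem_cons_self))
      have h2 := hdeg p.2
      rw [List.length_cons, Nat.mul_succ]
      omega
    · simp only [mul_smul]
      exact linearIndependent_pow_smul h.1 (fun i => g i • m) hli t

end RegularSequences

/-! ### Growth of Hilbert functions of graded modules -/

section GradedModules

variable {K : Type u} [Field K] {n : ℕ} {N : Type u} [AddCommGroup N] [Module K N]
  [Module (MvPolynomial (Fin n) K) N] {𝒩 : ℕ → Submodule K N}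

/-- The elements of degree at most `T`. -/
def degreeLE (𝒩 : ℕ → Submodule K N) (T : ℕ) : Submodule K N :=
  ⨆ i ∈ Finset.range (T + 1), 𝒩 i

theorem le_degreeLE {i T : ℕ} (h : i ≤ T) : 𝒩 i ≤ degreeLE 𝒩 T :=
  le_iSup₂_of_le (f := fun i (_ : i ∈ Finset.range (T + 1)) => 𝒩 i) i
    (Finset.mem_range.2 (by omega)) le_rfl

theorem degreeLE_mono : Monotone (degreeLE 𝒩) := fun _ _ h =>
  iSup₂_le fun _ hi => le_degreeLE ((Nat.lt_succ_iff.1 (Finset.mem_range.1 hi)).trans h)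

theorem finrank_degreeLE_le [∀ i, FiniteDimensional K (𝒩 i)] (T : ℕ) :
    FiniteDimensional K (degreeLE 𝒩 T) ∧
      Module.finrank K (degreeLE 𝒩 T) ≤ ∑ i ∈ Finset.range (T + 1), Module.finrank K (𝒩 i) := by
  unfold degreeLE
  induction Finset.range (T + 1) using Finset.induction_on with
  | empty =>
    have h : ⨆ i ∈ (∅ : Finset ℕ), 𝒩 i = ⊥ := by simp
    rw [h]
    exact ⟨inferInstance, by simp⟩
  | insert a s ha ih =>
    obtain ⟨_, h⟩ := ih
    rw [Finset.iSup_insert, Finset.sum_insert ha]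
    exact ⟨inferInstance, (Submodule.finrank_add_le_finrank_add_finrank _ _).trans
      (Nat.add_le_add_left h _)⟩

theorem IsGrading.exists_mem_degreeLE (h : IsGrading K n 𝒩) (m : N) :
    ∃ s, m ∈ degreeLE 𝒩 s := by
  have hm : m ∈ ⨆ i, 𝒩 i := by
    rw [h.isInternal.submodule_iSup_eq_top]
    trivial
  induction hm using Submodule.iSup_induction' with
  | mem i x hx => exact ⟨i, le_degreeLE le_rfl hx⟩
  | zero => exact ⟨0, zero_mem _⟩
  | add x y _ _ hx hy =>
    obtain ⟨s, hs⟩ := hx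
    obtain ⟨t, ht⟩ := hy
    exact ⟨max s t, add_mem (degreeLE_mono (le_max_left s t) hs)
      (degreeLE_mono (le_max_right s t) ht)⟩

theorem IsGrading.smul_mem_degreeLE (h : IsGrading K n 𝒩) {f : MvPolynomial (Fin n) K} {e s : ℕ}
    (hf : f.totalDegree ≤ e) {m : N} (hm : m ∈ degreeLE 𝒩 s) :
    f • m ∈ degreeLE 𝒩 (e + s) := by
  induction hm using Submodule.iSup_induction' with
  | mem i x hx =>
    by_cases hi : i ∈ Finset.range (s + 1)
    · rw [iSup_pos hi] at hx
      rw [← sum_homogeneousComponent f, Finset.sum_smul]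
      refine sum_mem fun a ha => ?_
      rw [Finset.mem_range] at ha hi
      exact le_degreeLE (by omega) (h.smul_mem a i _ x (homogeneousComponent_mem a f) hx)
    · rw [iSup_neg hi, Submodule.mem_bot] at hx
      simp [hx]
  | zero => simp
  | add x y _ _ hx hy => rw [smul_add]; exact add_mem hx hy

/-- Monomials of degree above `j` send all of `N` into degrees above `j`, so `𝒩 j` is spanned by the
projections of finitely many monomial multiples of generators, which need not be homogeneous.
Without finiteness `finrank` would be 0 and bound nothing. -/
theorem IsGrading.finiteDimensional [IsScalarTower K (MvPolynomial (Fin n) K) N]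
    (h : IsGrading K n 𝒩) [Module.Finite (MvPolynomial (Fin n) K) N] (j : ℕ) :
    FiniteDimensional K (𝒩 j) := by
  classical
  let e := LinearEquiv.ofBijective (DirectSum.coeLinearMap 𝒩) h.isInternal
  let proj : N →ₗ[K] 𝒩 j := DirectSum.component K ℕ (fun i => 𝒩 i) j ∘ₗ e.symm.toLinearMap
  have he : ∀ i (x : 𝒩 i), e.symm (x : N) = DirectSum.of (fun i => 𝒩 i) i x := fun i x => by
    rw [LinearEquiv.symm_apply_eq]
    exact (DirectSum.coeLinearMap_of 𝒩 i x).symm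
  have hself : ∀ x : 𝒩 j, proj x = x := fun x => by
    change e.symm (x : N) j = x
    rw [he, DirectSum.of_eq_same]
  have hne : ∀ i (x : N), x ∈ 𝒩 i → i ≠ j → proj x = 0 := fun i x hx hij => by
    change e.symm ((⟨x, hx⟩ : 𝒩 i) : N) j = 0
    rw [he, DirectSum.of_eq_of_ne _ _ _ hij.symm]
  obtain ⟨G, hG⟩ := Module.Finite.fg_top (R := MvPolynomial (Fin n) K) (M := N)
  let E : Finset (Fin n →₀ ℕ) := Finset.Iic (Finsupp.equivFunOnFinite.symm fun _ => j)
  let W : Submodule K (𝒩 j) := Submodule.span K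
    ((E ×ˢ G).image fun p => proj (monomial p.1 (1 : K) • p.2) : Finset (𝒩 j))
  have hmon : ∀ (α : Fin n →₀ ℕ), ∀ m ∈ G, proj (monomial α (1 : K) • m) ∈ W := by
    intro α m hm
    by_cases hα : α ∈ E
    · exact Submodule.subset_span (Finset.mem_coe.2 (Finset.mem_image.2
        ⟨(α, m), Finset.mem_product.2 ⟨hα, hm⟩, rfl⟩))
    · have hdeg : j < α.degree := by
        by_contra hle
        refine hα (Finset.mem_Iic.2 fun i => ?_)
        exact (Finsupp.le_degree i α).trans (not_lt.1 hle)
      have hm' : m ∈ ⨆ i, 𝒩 i := by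
        rw [h.isInternal.submodule_iSup_eq_top]
        trivial
      suffices proj (monomial α (1 : K) • m) = 0 by simp [this]
      clear hm
      induction hm' using Submodule.iSup_induction' with
      | mem i x hx =>
        exact hne (α.degree + i) _ (h.smul_mem _ _ _ _
          (isHomogeneous_monomial _ rfl) hx) (by omega)
      | zero => simp
      | add x y _ _ hx hy => rw [smul_add, map_add, hx, hy, add_zero]
  have hW : ∀ y : N, proj y ∈ W := by
    intro y
    have hy : y ∈ Submodule.span (MvPolynomial (Fin n) K) (G : Set N) := hG ▸ Submodule.mem_top
    obtain ⟨f, -, rfl⟩ := Submodule.mem_span_finset.1 hy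
    rw [map_sum]
    refine sum_mem fun m hm => ?_
    rw [(f m).as_sum, Finset.sum_smul, map_sum]
    refine sum_mem fun α _ => ?_
    have : (monomial α (coeff α (f m))) • m = coeff α (f m) • monomial α (1 : K) • m := by
      rw [← smul_assoc, smul_monomial, smul_eq_mul, mul_one]
    rw [this, map_smul]
    exact W.smul_mem _ (hmon α m hm)
  refine ⟨⟨_, (eq_top_iff.2 fun x _ => ?_ : W = ⊤)⟩⟩
  exact hself x ▸ hW x

/-- A regular sequence of length `r` forces the Hilbert function, summed up to `T`, to grow at least
like `T ^ r`. -/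
theorem IsGrading.exists_pow_le_sum_finrank [IsScalarTower K (MvPolynomial (Fin n) K) N]
    (h : IsGrading K n 𝒩) [Module.Finite (MvPolynomial (Fin n) K) N]
    {rs : List (MvPolynomial (Fin n) K)} (hrs : RingTheory.Sequence.IsRegular N rs) :
    ∃ s c : ℕ, ∀ t : ℕ, t ^ rs.length ≤
      ∑ i ∈ Finset.range (t * c + s + 1), Module.finrank K (𝒩 i) := by
  -- The sum of the total degrees serves as a common bound for each of them.
  obtain ⟨m, hm⟩ := exists_linearIndependent_smul (rs.map totalDegree).sum rs
    (fun r hr => List.single_le_sum (by simp) _ (List.mem_map_of_mem hr)) N hrs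
  obtain ⟨s, hs⟩ := h.exists_mem_degreeLE m
  refine ⟨s, (rs.map totalDegree).sum * rs.length, fun t => ?_⟩
  obtain ⟨ι, _, g, hcard, hdeg, hli⟩ := hm t
  have := h.finiteDimensional
  obtain ⟨_, hle⟩ := finrank_degreeLE_le (𝒩 := 𝒩) (t * ((rs.map totalDegree).sum * rs.length) + s)
  refine le_trans ?_ hle
  rw [← hcard]
  simp only [mul_assoc] at hdeg
  exact LinearIndependent.fintype_card_le_finrank
    (b := fun k => (⟨g k • m, h.smul_mem_degreeLE (hdeg k) hs⟩ : degreeLE 𝒩 _))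
    (LinearIndependent.of_comp (Submodule.subtype _) hli)

end GradedModules

/-- If `d < r`, dividing by `t ^ d` bounds every positive `t` by a constant. -/
theorem le_of_pow_le_mul_pow {r d C a s : ℕ} (h : ∀ t : ℕ, t ^ r ≤ C * (t * a + s + 1) ^ d) :
    r ≤ d := by
  by_contra! hlt
  have h' : ∀ t : ℕ, 0 < t → t ≤ C * (a + s + 1) ^ d := by
    intro t ht
    have h1 : t ^ d * t ≤ t ^ d * (C * (a + s + 1) ^ d) := calc
      t ^ d * t = t ^ (d + 1) := (pow_succ _ _).symm
      _ ≤ t ^ r := Nat.pow_le_pow_right ht hlt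
      _ ≤ C * (t * a + s + 1) ^ d := h t
      _ ≤ C * (t * (a + s + 1)) ^ d := by
        gcongr
        nlinarith
      _ = t ^ d * (C * (a + s + 1) ^ d) := by rw [mul_pow]; ring
    exact Nat.le_of_mul_le_mul_left h1 (by positivity)
  have := h' (C * (a + s + 1) ^ d + 1) (by omega)
  omega

/-! ### Squarefree monomial ideals and the Hilbert function of `J/I` -/

section MonomialIdeals

variable {K : Type u} [Field K] {n : ℕ} {I J : Ideal (MvPolynomial (Fin n) K)}

theorem sqfreeMonomial_eq_monomial (F : Finset (Fin n)) :
    sqfreeMonomial K F = monomial (∑ i ∈ F, Finsupp.single i 1) 1 := by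
  rw [monomial_sum_one]
  rfl

theorem sum_single_one_apply (F : Finset (Fin n)) (j : Fin n) :
    (∑ i ∈ F, Finsupp.single i 1 : Fin n →₀ ℕ) j = if j ∈ F then 1 else 0 := by
  simp [Finsupp.finsetSum_apply, Finsupp.single_apply]

theorem support_sum_single_one (F : Finset (Fin n)) :
    (∑ i ∈ F, Finsupp.single i 1 : Fin n →₀ ℕ).support = F := by
  ext j
  simp [sum_single_one_apply]

theorem sum_single_one_le_iff {F : Finset (Fin n)} {α : Fin n →₀ ℕ} :
    (∑ i ∈ F, Finsupp.single i 1 : Fin n →₀ ℕ) ≤ α ↔ F ⊆ α.support := by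
  simp only [Finsupp.le_def, sum_single_one_apply, Finset.subset_iff, Finsupp.mem_support_iff]
  refine forall_congr' fun i => ?_
  split_ifs with h <;> simp [h, Nat.one_le_iff_ne_zero]

theorem sqfreeMonomial_mem_of_subset {F G : Finset (Fin n)} (h : F ⊆ G)
    (hF : sqfreeMonomial K F ∈ I) : sqfreeMonomial K G ∈ I :=
  I.mem_of_dvd (Finset.prod_dvd_prod_of_subset F G _ h) hF

/-- Membership in a squarefree monomial ideal depends only on the supports of the monomials. -/
theorem IsSqfreeMonomialIdeal.mem_iff (hI : IsSqfreeMonomialIdeal I)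
    {f : MvPolynomial (Fin n) K} :
    f ∈ I ↔ ∀ α ∈ f.support, sqfreeMonomial K α.support ∈ I := by
  obtain ⟨A, rfl⟩ := hI
  have key : ∀ g : MvPolynomial (Fin n) K, g ∈ Ideal.span (sqfreeMonomial K '' A) ↔
      ∀ α ∈ g.support, ∃ F ∈ A, F ⊆ α.support := by
    intro g
    have : sqfreeMonomial K '' A = (fun s => monomial s (1 : K)) ''
        ((fun F : Finset (Fin n) => ∑ i ∈ F, Finsupp.single i 1) '' A) := by
      rw [Set.image_image]
      exact Set.image_congr fun F _ => sqfreeMonomial_eq_monomial F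
    rw [this, mem_ideal_span_monomial_image]
    simp only [Set.exists_mem_image, sum_single_one_le_iff]
  rw [key]
  refine forall₂_congr fun α _ => ?_
  classical
  rw [key, sqfreeMonomial_eq_monomial, support_monomial, if_neg one_ne_zero]
  simp only [Finset.mem_singleton, forall_eq, support_sum_single_one]

theorem IsSqfreeMonomialIdeal.monomial_mem_iff (hI : IsSqfreeMonomialIdeal I)
    {α : Fin n →₀ ℕ} {c : K} (hc : c ≠ 0) :
    monomial α c ∈ I ↔ sqfreeMonomial K α.support ∈ I := by
  classical
  rw [hI.mem_iff, support_monomial, if_neg hc]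
  simp

theorem IsSqfreeMonomialIdeal.homogeneousComponent_mem (hI : IsSqfreeMonomialIdeal I)
    {f : MvPolynomial (Fin n) K} (hf : f ∈ I) (j : ℕ) : homogeneousComponent j f ∈ I := by
  rw [hI.mem_iff] at hf ⊢
  intro α hα
  refine hf α ?_
  rw [mem_support_iff, coeff_homogeneousComponent] at hα
  rw [mem_support_iff]
  exact fun h => hα (by simp [h])

theorem mem_support_sqfreeMonomial_mul {f : MvPolynomial (Fin n) K} {F : Finset (Fin n)}
    {α : Fin n →₀ ℕ} (hα : α ∈ f.support) :
    α + ∑ i ∈ F, Finsupp.single i 1 ∈ (f * sqfreeMonomial K F).support := by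
  rw [mem_support_iff] at hα ⊢
  rwa [sqfreeMonomial_eq_monomial, coeff_mul_monomial, mul_one]

theorem support_add_sum_single_one (α : Fin n →₀ ℕ) (F : Finset (Fin n)) :
    (α + ∑ i ∈ F, Finsupp.single i 1).support = α.support ∪ F := by
  ext j
  rw [Finsupp.mem_support_iff, Finsupp.add_apply, sum_single_one_apply, Finset.mem_union,
    Finsupp.mem_support_iff]
  by_cases h : j ∈ F <;> simp [h]

theorem mk_eq_zero_iff {f : J} :
    (Submodule.Quotient.mk f : QuotMod I J) = 0 ↔ (f : MvPolynomial (Fin n) K) ∈ I := by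
  rw [Submodule.Quotient.mk_eq_zero]
  rfl

theorem mem_quotGrading {j : ℕ} {x : QuotMod I J} :
    x ∈ quotGrading I J j ↔
      ∃ f : J, (f : MvPolynomial (Fin n) K) ∈ homogeneousSubmodule (Fin n) K j ∧
        (Submodule.Quotient.mk f : QuotMod I J) = x :=
  Iff.rfl

theorem isGrading_quotGrading (hI : IsSqfreeMonomialIdeal I) (hJ : IsSqfreeMonomialIdeal J) :
    IsGrading K n (quotGrading I J) where
  isInternal := by
    classical
    constructor
    · refine (injective_iff_map_eq_zero _).2 fun x hx => ?_
      choose f hf hfx using fun j => mem_quotGrading.1 (x j).2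
      rw [DirectSum.coeAddMonoidHom_eq_dfinsuppSum, DFinsupp.sum] at hx
      have hsum : (Submodule.Quotient.mk (∑ j ∈ x.support, f j) : QuotMod I J) = 0 := by
        rw [← hx]
        refine (map_sum (Submodule.submoduleOf I J).mkQ f x.support).trans ?_
        exact Finset.sum_congr rfl fun j _ => hfx j
      rw [mk_eq_zero_iff] at hsum
      ext j
      by_cases hj : j ∈ x.support
      -- As `I` is homogeneous, each component `f j` of the sum lies in `I` separately.
      · have := hI.homogeneousComponent_mem hsum j
        rw [AddSubmonoidClass.coe_finsetSum, map_sum, Finset.sum_eq_single j] at this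
        · rw [homogeneousComponent_of_mem (hf j), if_pos rfl] at this
          rw [← hfx j, mk_eq_zero_iff.2 this]
          rfl
        · intro i _ hij
          rw [homogeneousComponent_of_mem (hf i), if_neg hij.symm]
        · exact fun h => (h hj).elim
      · rw [DFinsupp.notMem_support_iff.1 hj]
        rfl
    · intro y
      obtain ⟨f, rfl⟩ := Submodule.Quotient.mk_surjective _ y
      have hf : f = ∑ j ∈ Finset.range ((f : MvPolynomial (Fin n) K).totalDegree + 1),
          (⟨homogeneousComponent j (f : MvPolynomial (Fin n) K),
            hJ.homogeneousComponent_mem f.2 j⟩ : J) := by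
        apply Subtype.ext
        rw [AddSubmonoidClass.coe_finsetSum]
        exact (sum_homogeneousComponent _).symm
      refine ⟨∑ j ∈ Finset.range ((f : MvPolynomial (Fin n) K).totalDegree + 1),
        DirectSum.of (fun j => quotGrading I J j) j ⟨Submodule.Quotient.mk
          ⟨homogeneousComponent j (f : MvPolynomial (Fin n) K),
            hJ.homogeneousComponent_mem f.2 j⟩, mem_quotGrading.2
          ⟨_, homogeneousComponent_mem _ _, rfl⟩⟩, ?_⟩
      rw [map_sum]
      simp only [DirectSum.coeAddMonoidHom_of]
      conv_rhs => rw [hf]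
      exact (map_sum (Submodule.submoduleOf I J).mkQ _ _).symm
  smul_mem := by
    intro i j f m hf hm
    obtain ⟨g, hg, rfl⟩ := mem_quotGrading.1 hm
    exact mem_quotGrading.2 ⟨f • g, IsHomogeneous.mul hf hg, rfl⟩

/-- The exponent vectors with entries at most `T` and at most `d` nonzero entries. -/
noncomputable def sparseExponents (n d T : ℕ) : Finset (Fin n →₀ ℕ) :=
  (Finset.Iic (Finsupp.equivFunOnFinite.symm fun _ => T)).filter fun α => α.support.card ≤ d

/-- The boxes `{0, …, T}^F` with `|F| ≤ d` cover these exponents, and there are at most `2 ^ n` sets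
`F`. -/
theorem card_sparseExponents_le (n d T : ℕ) :
    (sparseExponents n d T).card ≤ 2 ^ n * (T + 1) ^ d := by
  classical
  let B : Finset (Fin n) → Finset (Fin n → ℕ) := fun F =>
    Fintype.piFinset fun i => if i ∈ F then Finset.range (T + 1) else {0}
  have hB : ∀ F, (B F).card = (T + 1) ^ F.card := fun F => by
    simp only [B, Fintype.card_piFinset, apply_ite Finset.card, Finset.card_range,
      Finset.card_singleton]
    rw [Finset.prod_ite_mem]
    simp
  calc (sparseExponents n d T).card
      = ((sparseExponents n d T).image fun α : Fin n →₀ ℕ => (α : Fin n → ℕ)).card :=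
        (Finset.card_image_of_injective _ DFunLike.coe_injective).symm
    _ ≤ ((Finset.univ.filter fun F : Finset (Fin n) => F.card ≤ d).biUnion B).card := by
        refine Finset.card_le_card fun f hf => ?_
        obtain ⟨α, hα, rfl⟩ := Finset.mem_image.1 hf
        obtain ⟨hα, hd⟩ := Finset.mem_filter.1 hα
        refine Finset.mem_biUnion.2 ⟨α.support, by simpa using hd, Fintype.mem_piFinset.2 ?_⟩
        intro i
        by_cases hi : i ∈ α.support
        · rw [if_pos hi, Finset.mem_range]
          exact Nat.lt_succ_of_le (Finset.mem_Iic.1 hα i)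
        · rw [if_neg hi]
          simpa using hi
    _ ≤ ∑ F ∈ Finset.univ.filter (fun F : Finset (Fin n) => F.card ≤ d), (B F).card :=
        Finset.card_biUnion_le
    _ ≤ ∑ F ∈ Finset.univ.filter (fun F : Finset (Fin n) => F.card ≤ d), (T + 1) ^ d := by
        refine Finset.sum_le_sum fun F hF => ?_
        rw [hB]
        exact Nat.pow_le_pow_right (by omega) (Finset.mem_filter.1 hF).2
    _ ≤ 2 ^ n * (T + 1) ^ d := by
        rw [Finset.sum_const, smul_eq_mul]
        refine Nat.mul_le_mul_right _ ((Finset.card_filter_le _ _).trans ?_)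
        simp

/-- The monomials in `J` but not in `I` span. Keeping `T` apart from `j` makes the bounds for all `j
≤ T` fibre sizes of one finite set, ready to be summed. -/
theorem finrank_quotGrading_le (hI : IsSqfreeMonomialIdeal I) (hJ : IsSqfreeMonomialIdeal J)
    {d : ℕ} (hd : ∀ F : Finset (Fin n), sqfreeMonomial K F ∉ I → sqfreeMonomial K F ∈ J →
      F.card ≤ d) {j T : ℕ} (hj : j ≤ T) :
    Module.finrank K (quotGrading I J j) ≤
      ((sparseExponents n d T).filter fun α => α.degree = j).card := by
  classical
  let v : (Fin n →₀ ℕ) → QuotMod I J := fun α =>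
    if h : monomial α (1 : K) ∈ J then Submodule.Quotient.mk ⟨_, h⟩ else 0
  let A := ((sparseExponents n d T).filter fun α => α.degree = j).image v
  have hle : quotGrading I J j ≤ Submodule.span K (A : Set (QuotMod I J)) := by
    intro x hx
    obtain ⟨f, hf, rfl⟩ := mem_quotGrading.1 hx
    have hmem : ∀ α ∈ (f : MvPolynomial (Fin n) K).support, monomial α (1 : K) ∈ J := fun α hα =>
      (hJ.monomial_mem_iff one_ne_zero).2 (hJ.mem_iff.1 f.2 α hα)
    have hsum : f = ∑ α ∈ (f : MvPolynomial (Fin n) K).support.attach,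
        coeff α.1 (f : MvPolynomial (Fin n) K) •
          (⟨monomial α.1 (1 : K), hmem α.1 α.2⟩ : J) := by
      apply Subtype.ext
      rw [AddSubmonoidClass.coe_finsetSum]
      conv_lhs => rw [(f : MvPolynomial (Fin n) K).as_sum, ← Finset.sum_attach]
      refine Finset.sum_congr rfl fun α _ => ?_
      rw [Submodule.coe_smul_of_tower, smul_monomial, smul_eq_mul, mul_one]
    rw [hsum]
    change ((Submodule.submoduleOf I J).mkQ.restrictScalars K) _ ∈ _
    rw [map_sum]
    refine sum_mem fun α _ => ?_
    rw [map_smul]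
    refine Submodule.smul_mem _ _ ?_
    change (Submodule.Quotient.mk _ : QuotMod I J) ∈ _
    by_cases hαI : monomial α.1 (1 : K) ∈ I
    · rw [mk_eq_zero_iff.2 hαI]
      exact zero_mem _
    · refine Submodule.subset_span (Finset.mem_coe.2 (Finset.mem_image.2 ⟨α.1, ?_, ?_⟩))
      · have hdeg : α.1.degree = j := by
          have := hf (mem_support_iff.1 α.2)
          rwa [Finsupp.degree_eq_weight_one]
        refine Finset.mem_filter.2 ⟨Finset.mem_filter.2 ⟨Finset.mem_Iic.2 fun i => ?_, ?_⟩, hdeg⟩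
        · exact ((Finsupp.le_degree i α.1).trans hdeg.le).trans hj
        · exact hd _ (fun h => hαI ((hI.monomial_mem_iff one_ne_zero).2 h))
            ((hJ.monomial_mem_iff one_ne_zero).1 (hmem α.1 α.2))
      · simp only [v]
        rw [dif_pos (hmem α.1 α.2)]
  calc Module.finrank K (quotGrading I J j)
      ≤ Module.finrank K (Submodule.span K (A : Set (QuotMod I J))) :=
        Submodule.finrank_mono hle
    _ ≤ A.card := finrank_span_finset_le_card A
    _ ≤ _ := Finset.card_image_le

theorem sum_finrank_quotGrading_le (hI : IsSqfreeMonomialIdeal I) (hJ : IsSqfreeMonomialIdeal J)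
    {d : ℕ} (hd : ∀ F : Finset (Fin n), sqfreeMonomial K F ∉ I → sqfreeMonomial K F ∈ J →
      F.card ≤ d) (T : ℕ) :
    ∑ j ∈ Finset.range (T + 1), Module.finrank K (quotGrading I J j) ≤ 2 ^ n * (T + 1) ^ d := by
  classical
  refine le_trans ?_ (card_sparseExponents_le n d T)
  refine (Finset.sum_le_sum fun j hj => finrank_quotGrading_le hI hJ hd
    (Nat.lt_succ_iff.1 (Finset.mem_range.1 hj))).trans ?_
  rw [Finset.sum_card_fiberwise_eq_card_filter]
  exact Finset.card_filter_le _ _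

theorem hilbertDepth_quotGrading_le (hI : IsSqfreeMonomialIdeal I) (hJ : IsSqfreeMonomialIdeal J)
    {d : ℕ} (hd : ∀ F : Finset (Fin n), sqfreeMonomial K F ∉ I → sqfreeMonomial K F ∈ J →
      F.card ≤ d) :
    hilbertDepth n (quotGrading I J) ≤ d := by
  refine sSup_le ?_
  rintro _ ⟨N, _, _, _, _, 𝒩, hgr, hfin, hseries, rfl⟩
  refine sSup_le ?_
  rintro _ ⟨rs, -, hrs, rfl⟩
  have hrank : ∀ j, Module.finrank K (𝒩 j) = Module.finrank K (quotGrading I J j) := fun j => by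
    have := congrArg (PowerSeries.coeff j) hseries
    simpa [hilbertSeries] using this
  obtain ⟨s, c, h⟩ := hgr.exists_pow_le_sum_finrank hrs
  simp only [hrank] at h
  exact_mod_cast le_of_pow_le_mul_pow fun t =>
    (h t).trans (sum_finrank_quotGrading_le hI hJ hd (t * c + s))

theorem depth_le_hilbertDepth (hI : IsSqfreeMonomialIdeal I) (hJ : IsSqfreeMonomialIdeal J) :
    depth K n (QuotMod I J) ≤ hilbertDepth n (quotGrading I J) :=
  le_sSup ⟨QuotMod I J, inferInstance, inferInstance, inferInstance, inferInstance,
    quotGrading I J, isGrading_quotGrading hI hJ, inferInstance, rfl, rfl⟩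

end MonomialIdeals

/-! ### Krull dimension of `J/I` and of the relative complex -/

section Dimension

variable {K : Type u} [Field K] {n : ℕ} {I J : Ideal (MvPolynomial (Fin n) K)}

/-- The quotient of a polynomial ring by variables is a polynomial ring in the others. -/
theorem ringKrullDim_quotient_span_X_le (G : Finset (Fin n)) :
    ringKrullDim (MvPolynomial (Fin n) K ⧸
      Ideal.span (X '' (Gᶜ : Set (Fin n)) : Set (MvPolynomial (Fin n) K))) ≤ G.card := by
  let P := Ideal.span (X '' ((G : Set (Fin n))ᶜ) : Set (MvPolynomial (Fin n) K))
  let φ : MvPolynomial G K →ₐ[K] MvPolynomial (Fin n) K ⧸ P :=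
    (Ideal.Quotient.mkₐ K P).comp (rename (fun i : G => (i : Fin n)))
  have hφ : Function.Surjective φ := by
    intro y
    obtain ⟨f, rfl⟩ := Ideal.Quotient.mk_surjective y
    induction f using MvPolynomial.induction_on with
    | C a => exact ⟨C a, by simp [φ]; rfl⟩
    | add p q hp hq =>
      obtain ⟨p', hp⟩ := hp
      obtain ⟨q', hq⟩ := hq
      exact ⟨p' + q', by rw [map_add, map_add, hp, hq]⟩
    | mul_X p i hp =>
      obtain ⟨p', hp⟩ := hp
      by_cases hi : i ∈ G
      · exact ⟨p' * X ⟨i, hi⟩, by rw [map_mul, map_mul, hp]; simp [φ]⟩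
      · refine ⟨0, ?_⟩
        have : Ideal.Quotient.mk P (X i) = 0 :=
          Ideal.Quotient.eq_zero_iff_mem.2 (Ideal.subset_span ⟨i, hi, rfl⟩)
        rw [map_mul, this, mul_zero, map_zero]
  refine (ringKrullDim_le_of_surjective φ.toRingHom hφ).trans ?_
  rw [ringKrullDim_of_isNoetherianRing, ringKrullDim_eq_zero_of_field]
  simp

/-- A chain of primes starting at `q` stays above the variables in `q`, so its length is at most the
number of variables outside `q`. Those variables form a set `G` contained in a face of `Δ \ Γ`. -/
theorem supportDim_quotMod_le (hI : IsSqfreeMonomialIdeal I) (hJ : IsSqfreeMonomialIdeal J)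
    {d : ℕ} (hd : ∀ F : Finset (Fin n), sqfreeMonomial K F ∉ I → sqfreeMonomial K F ∈ J →
      F.card ≤ d) :
    Module.supportDim (MvPolynomial (Fin n) K) (QuotMod I J) ≤ d := by
  classical
  refine iSup_le fun p => ?_
  let q : PrimeSpectrum (MvPolynomial (Fin n) K) := p.head.1
  let G : Finset (Fin n) := Finset.univ.filter fun i => X i ∉ q.asIdeal
  let P := Ideal.span (X '' ((G : Set (Fin n))ᶜ) : Set (MvPolynomial (Fin n) K))
  have hPq : P ≤ q.asIdeal := by
    refine Ideal.span_le.2 ?_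
    rintro _ ⟨i, hi, rfl⟩
    simpa [G] using hi
  have hG : G.card ≤ d := by
    obtain ⟨m, hm⟩ := Module.mem_support_iff'.1 p.head.2
    obtain ⟨f, rfl⟩ := Submodule.Quotient.mk_surjective _ m
    have hGq : sqfreeMonomial K G ∉ q.asIdeal := fun h => by
      obtain ⟨i, hi, hiq⟩ := q.isPrime.prod_mem_iff.1 h
      exact (Finset.mem_filter.1 hi).2 hiq
    -- Some monomial `β` of `f * x_G` avoids `I`. Its support contains `G`, and it is a face outside
    -- `Γ` since `β` minus the exponent of `x_G` occurs in `f ∈ J`.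
    have hfI : (f : MvPolynomial (Fin n) K) * sqfreeMonomial K G ∉ I := fun h =>
      hm _ hGq (mk_eq_zero_iff.2 (by simpa [mul_comm] using h))
    rw [hI.mem_iff] at hfI
    push Not at hfI
    obtain ⟨β, hβ, hβI⟩ := hfI
    rw [mem_support_iff, sqfreeMonomial_eq_monomial, coeff_mul_monomial', mul_one] at hβ
    have hle : ∑ i ∈ G, Finsupp.single i 1 ≤ β := by
      by_contra h
      exact hβ (if_neg h)
    rw [if_pos hle] at hβ
    refine (Finset.card_le_card (sum_single_one_le_iff.1 hle)).trans (hd _ hβI ?_)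
    refine sqfreeMonomial_mem_of_subset (Finsupp.support_tsub (f2 := ∑ i ∈ G, Finsupp.single i 1)) ?_
    exact hJ.mem_iff.1 f.2 _ (mem_support_iff.2 hβ)
  have hp : ∀ k, (p k).1 ∈ PrimeSpectrum.zeroLocus (P : Set (MvPolynomial (Fin n) K)) :=
    fun k => hPq.trans (show q ≤ (p k).1 from p.monotone (Fin.zero_le k))
  let p' : LTSeries (PrimeSpectrum.zeroLocus (P : Set (MvPolynomial (Fin n) K))) :=
    ⟨p.length, fun k => ⟨(p k).1, hp k⟩, fun k => p.step k⟩
  calc (p.length : WithBot ℕ∞)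
      ≤ Order.krullDim (PrimeSpectrum.zeroLocus (P : Set (MvPolynomial (Fin n) K))) :=
        Order.LTSeries.length_le_krullDim p'
    _ = ringKrullDim (MvPolynomial (Fin n) K ⧸ P) := (ringKrullDim_quotient P).symm
    _ ≤ G.card := ringKrullDim_quotient_span_X_le G
    _ ≤ d := by exact_mod_cast hG

/-- The annihilator of the class of `x_F` lies in the ideal of the variables outside `F`. Setting
these to zero therefore embeds the spectrum of a polynomial ring in `|F|` variables into the
support. -/
theorem card_le_supportDim_quotMod (hI : IsSqfreeMonomialIdeal I) {F : Finset (Fin n)}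
    (hFI : sqfreeMonomial K F ∉ I) (hFJ : sqfreeMonomial K F ∈ J) :
    (F.card : WithBot ℕ∞) ≤ Module.supportDim (MvPolynomial (Fin n) K) (QuotMod I J) := by
  classical
  let φ : MvPolynomial (Fin n) K →ₐ[K] MvPolynomial F K :=
    aeval fun i => if h : i ∈ F then X ⟨i, h⟩ else 0
  have hφ : Function.Surjective φ := by
    intro f
    refine ⟨rename (fun i : F => (i : Fin n)) f, ?_⟩
    rw [aeval_rename]
    convert! aeval_X_left_apply f using 2
    ext i
    simp
  have hker : ∀ r, r * sqfreeMonomial K F ∈ I → φ r = 0 := by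
    intro r hr
    have hr' : r ∈ Ideal.span (X '' ((F : Set (Fin n))ᶜ) : Set (MvPolynomial (Fin n) K)) := by
      rw [mem_ideal_span_X_image]
      intro α hα
      -- An exponent `α` supported in `F` would give `α + ∑ i ∈ F, single i 1` support exactly `F`,
      -- putting `x_F` in `I`.
      by_contra! hcon
      have := hI.mem_iff.1 hr _ (mem_support_sqfreeMonomial_mul hα)
      rw [support_add_sum_single_one, Finset.union_eq_right.2] at this
      · exact hFI this
      · intro i hi
        by_contra hiF
        exact Finsupp.mem_support_iff.1 hi (hcon i hiF)
    have hle : Ideal.span (X '' ((F : Set (Fin n))ᶜ) : Set (MvPolynomial (Fin n) K)) ≤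
        RingHom.ker φ := by
      refine Ideal.span_le.2 ?_
      rintro _ ⟨i, hi, rfl⟩
      simpa [φ, RingHom.mem_ker] using hi
    exact hle hr'
  have hsupp : ∀ q : PrimeSpectrum (MvPolynomial F K), PrimeSpectrum.comap φ.toRingHom q ∈
      Module.support (MvPolynomial (Fin n) K) (QuotMod I J) := by
    intro q
    refine Module.mem_support_iff'.2 ⟨Submodule.Quotient.mk ⟨_, hFJ⟩, fun r hr h0 => hr ?_⟩
    have : φ r = 0 := hker r (mk_eq_zero_iff.1 h0)
    change φ r ∈ q.asIdeal
    rw [this]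
    exact zero_mem _
  have hmono : StrictMono fun q : PrimeSpectrum (MvPolynomial F K) =>
      (⟨PrimeSpectrum.comap φ.toRingHom q, hsupp q⟩ :
        Module.support (MvPolynomial (Fin n) K) (QuotMod I J)) := by
    refine Monotone.strictMono_of_injective (fun q q' h => Ideal.comap_mono h) fun q q' h => ?_
    exact PrimeSpectrum.comap_injective_of_surjective φ.toRingHom hφ (congrArg Subtype.val h)
  have hdim : ringKrullDim (MvPolynomial F K) = F.card := by
    rw [ringKrullDim_of_isNoetherianRing, ringKrullDim_eq_zero_of_field]
    simp
  rw [← hdim]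
  exact Order.krullDim_le_of_strictMono _ hmono

/-- A face of maximal size of the relative complex of `I < J`. -/
theorem exists_card_maximal_face (hJ : IsSqfreeMonomialIdeal J) (hIJ : I < J) :
    ∃ F : Finset (Fin n), sqfreeMonomial K F ∉ I ∧ sqfreeMonomial K F ∈ J ∧
      ∀ G : Finset (Fin n), sqfreeMonomial K G ∉ I → sqfreeMonomial K G ∈ J →
        G.card ≤ F.card := by
  classical
  let A : Finset (Finset (Fin n)) :=
    Finset.univ.filter fun F => sqfreeMonomial K F ∉ I ∧ sqfreeMonomial K F ∈ J
  have hA : A.Nonempty := by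
    obtain ⟨B, rfl⟩ := hJ
    by_contra h
    refine hIJ.not_ge (Ideal.span_le.2 ?_)
    rintro _ ⟨F, hF, rfl⟩
    by_contra hFI
    exact h ⟨F, Finset.mem_filter.2
      ⟨Finset.mem_univ F, hFI, Ideal.subset_span ⟨F, hF, rfl⟩⟩⟩
  obtain ⟨F, hF, hmax⟩ := A.exists_max_image Finset.card hA
  obtain ⟨-, hFI, hFJ⟩ := Finset.mem_filter.1 hF
  exact ⟨F, hFI, hFJ, fun G hGI hGJ =>
    hmax G (Finset.mem_filter.2 ⟨Finset.mem_univ G, hGI, hGJ⟩)⟩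

theorem relDim_eq {F : Finset (Fin n)} (hFI : sqfreeMonomial K F ∉ I)
    (hFJ : sqfreeMonomial K F ∈ J)
    (hmax : ∀ G : Finset (Fin n), sqfreeMonomial K G ∉ I → sqfreeMonomial K G ∈ J →
      G.card ≤ F.card) :
    relDim (stanleyReisnerComplex I) (stanleyReisnerComplex J) = (F.card : ℤ) - 1 := by
  -- The supremum in `ℤ` is meaningful only for nonempty bounded sets; an attained maximum gives
  -- both.
  refine IsGreatest.csSup_eq ⟨⟨F, ⟨hFI, not_not.2 hFJ⟩, rfl⟩, ?_⟩
  rintro _ ⟨G, ⟨hGI, hGJ⟩, rfl⟩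
  have := hmax G hGI (not_not.1 hGJ)
  simp only
  omega

end Dimension

end SqfreeHilbertDepth

theorem theorem3p2 {K : Type u} [Field K] [Infinite K] {n : ℕ}
    (I J : Ideal (MvPolynomial (Fin n) K))
    (hI : SqfreeHilbertDepth.IsSqfreeMonomialIdeal I)
    (hJ : SqfreeHilbertDepth.IsSqfreeMonomialIdeal J) (hIJ : I < J) :
    (∃ d : ℕ,
      Module.supportDim (MvPolynomial (Fin n) K) (SqfreeHilbertDepth.QuotMod I J) = d ∧
      (d : ℤ) = SqfreeHilbertDepth.relDim (SqfreeHilbertDepth.stanleyReisnerComplex I)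
        (SqfreeHilbertDepth.stanleyReisnerComplex J) + 1) ∧
    (SqfreeHilbertDepth.hilbertDepth n (SqfreeHilbertDepth.quotGrading I J) : WithBot ℕ∞) ≤
      Module.supportDim (MvPolynomial (Fin n) K) (SqfreeHilbertDepth.QuotMod I J) ∧
    (SqfreeHilbertDepth.IsCohenMacaulay K n (SqfreeHilbertDepth.QuotMod I J) →
      (SqfreeHilbertDepth.hilbertDepth n (SqfreeHilbertDepth.quotGrading I J) : WithBot ℕ∞) =
        Module.supportDim (MvPolynomial (Fin n) K) (SqfreeHilbertDepth.QuotMod I J) ∧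
      Module.supportDim (MvPolynomial (Fin n) K) (SqfreeHilbertDepth.QuotMod I J) =
        (SqfreeHilbertDepth.depth K n (SqfreeHilbertDepth.QuotMod I J) : WithBot ℕ∞)) := by
  obtain ⟨F, hFI, hFJ, hmax⟩ := SqfreeHilbertDepth.exists_card_maximal_face hJ hIJ
  have hdim : Module.supportDim (MvPolynomial (Fin n) K) (SqfreeHilbertDepth.QuotMod I J) =
      F.card :=
    le_antisymm (SqfreeHilbertDepth.supportDim_quotMod_le hI hJ hmax)
      (SqfreeHilbertDepth.card_le_supportDim_quotMod hI hFI hFJ)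
  have hle : (SqfreeHilbertDepth.hilbertDepth n (SqfreeHilbertDepth.quotGrading I J) :
      WithBot ℕ∞) ≤
      Module.supportDim (MvPolynomial (Fin n) K) (SqfreeHilbertDepth.QuotMod I J) := by
    rw [hdim]
    exact_mod_cast SqfreeHilbertDepth.hilbertDepth_quotGrading_le hI hJ hmax
  refine ⟨⟨F.card, hdim, ?_⟩, hle, fun hCM => ⟨le_antisymm hle ?_, hCM.symm⟩⟩
  · rw [SqfreeHilbertDepth.relDim_eq hFI hFJ hmax, sub_add_cancel]
  · rw [← show _ = _ from hCM]
    exact WithBot.coe_le_coe.2 (SqfreeHilbertDepth.depth_le_hilbertDepth hI hJ)
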